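/- Let $A_1$ be the Weyl algebra of one bosonic mode, i.e. the unital associative complex algebra generated by $a$ and $a^\dagger$ subject to $[a,a^\dagger]=aa^\dagger-a^\dagger a=1$, and let $(\cdot)^\dagger:A_1\to A_1$ be the conjugate-linear anti-automorphism that exchanges $a$ and $a^\dagger$. Let $\hat A_1=\{p\in A_1 : p^\dagger=-p\}$, a real Lie algebra under the commutator, and put (real spans) $$\hat A_1^0=\operatorname{span}\{i,\ i a^\dagger a\},\qquad \hat A_1^1=\operatorname{span}\{i(a+a^\dagger),\ a-a^\dagger\},\qquad \hat A_1^2=\operatorname{span}\{i(a^2+(a^\dagger)^2),\ a^2-(a^\dagger)^2\}.$$ The real Schrödinger algebra $\mathcal S$ is the six-dimensional real Lie algebra with basis $h,x,y,q,p,z$ and commutation relations $[h,x]=2x$, $[h,y]=-2y$, $[x,y]=h$, $[h,q]=q$, $[h,p]=-p$, $[x,q]=0$, $[x,p]=q$, $[y,q]=p$, $[y,p]=0$, $[q,p]=z$, and $[z,\cdot]=0$. Let $\mathfrak h_1$ be the real Heisenberg algebra with basis $q,p,z$, with $[q,p]=z$ and $z$ central, and let $\mathfrak{sl}(2,\mathbb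 R)\ltimes\mathfrak h_1$ be the semidirect sum in which $\mathfrak{sl}(2,\mathbb R)$ acts on $\operatorname{span}\{q,p\}\cong\mathbb R^2$ by the standard representation and trivially on $z$. The sum of $\hat A_1^0,\hat A_1^1,\hat A_1^2$ is direct, and the real Lie algebra $\langle\hat A_1^0\oplus\hat A_1^1\oplus\hat A_1^2\rangle_{\mathrm{Lie}}$ that it generates is a subalgebra of $\hat A_1$ with $$\langle\hat A_1^0\oplus\hat A_1^1\oplus\hat A_1^2\rangle_{\mathrm{Lie}}\;\cong\;\mathcal S\;\cong\;\mathfrak{sl}(2,\mathbb R)\ltimes\mathfrak h_1 .$$ Moreover, every finite-dimensional non-abelian real Lie subalgebra $\mathfrak g\subseteq\hat A_1$ that contains a free term $i a^\dagger a+ic$ for some $c\in\mathbb R$ satisfies $$\mathfrak g\subseteq\langle\hat A_1^0\oplus\hat A_1^1\oplus\hat A_1^2\rangle_{\mathrm{Lie}}\qquad\text{and}\qquad \dim_{\mathbb R}\mathfrak g\ge 3 .$$ -/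

import Mathlib

namespace Weyl

/-! ### The complex Weyl algebra of one bosonic mode -/

/-- The two generators: the annihilation operator and the creation operator. -/
inductive Gen : Type
  | ann : Gen
  | cre : Gen

/-- Exchange of the two generators. -/
def Gen.swap : Gen → Gen
  | Gen.ann => Gen.cre
  | Gen.cre => Gen.ann

/-- The canonical commutation relation `a a† = a† a + 1`. -/
inductive CCR : FreeAlgebra ℂ Gen → FreeAlgebra ℂ Gen → Prop
  | comm : CCR (FreeAlgebra.ι ℂ Gen.ann * FreeAlgebra.ι ℂ Gen.cre)
      (FreeAlgebra.ι ℂ Gen.cre * FreeAlgebra.ι ℂ Gen.ann + 1)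

/-- The Weyl algebra `A₁`: the unital associative complex algebra generated by `a` and `a†`
subject to `[a, a†] = 1`. -/
def A₁ : Type := RingQuot CCR

noncomputable instance : Ring A₁ := inferInstanceAs (Ring (RingQuot CCR))

noncomputable instance : Algebra ℂ A₁ := inferInstanceAs (Algebra ℂ (RingQuot CCR))

/-- `A₁` as a Lie ring, with the commutator as bracket. -/
noncomputable instance : LieRing A₁ := LieRing.ofAssociativeRing

/-- The quotient map from the free algebra. -/
noncomputable def mk : FreeAlgebra ℂ Gen →ₐ[ℂ] A₁ := RingQuot.mkAlgHom ℂ CCR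

theorem mk_surjective : Function.Surjective mk := RingQuot.mkAlgHom_surjective ℂ CCR

/-- The class in `A₁` of a generator. -/
noncomputable def gen (g : Gen) : A₁ := mk (FreeAlgebra.ι ℂ g)

/-- The annihilation operator `a`. -/
noncomputable def a : A₁ := gen Gen.ann

/-- The creation operator `a†`. -/
noncomputable def ad : A₁ := gen Gen.cre

theorem a_mul_ad : a * ad = ad * a + 1 := by
  have h : mk _ = mk _ := RingQuot.mkAlgHom_rel ℂ CCR.comm
  simpa [a, ad, gen] using h

/-- The universal property of `A₁`. -/
noncomputable def lift {B : Type*} [Ring B] [Algebra ℂ B] (f : Gen → B)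
    (hf : f Gen.ann * f Gen.cre = f Gen.cre * f Gen.ann + 1) : A₁ →ₐ[ℂ] B :=
  RingQuot.liftAlgHom ℂ (s := CCR) ⟨FreeAlgebra.lift ℂ f, by
    rintro _ _ ⟨⟩
    simpa using hf⟩

theorem lift_gen {B : Type*} [Ring B] [Algebra ℂ B] (f : Gen → B)
    (hf : f Gen.ann * f Gen.cre = f Gen.cre * f Gen.ann + 1) (g : Gen) :
    lift f hf (gen g) = f g := by
  have h : lift f hf (gen g) = FreeAlgebra.lift ℂ f (FreeAlgebra.ι ℂ g) :=
    RingQuot.liftAlgHom_mkAlgHom_apply ℂ _ _ _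
  rw [h, FreeAlgebra.lift_ι_apply]

theorem induct {P : A₁ → Prop} (hc : ∀ c : ℂ, P (algebraMap ℂ A₁ c)) (hg : ∀ g, P (gen g))
    (hmul : ∀ x y, P x → P y → P (x * y)) (hadd : ∀ x y, P x → P y → P (x + y)) (x : A₁) :
    P x := by
  obtain ⟨y, rfl⟩ := mk_surjective x
  induction y using FreeAlgebra.induction with
  | grade0 c => simpa using hc c
  | grade1 g => exact hg g
  | mul x y hx hy => simpa using hmul _ _ hx hy
  | add x y hx hy => simpa using hadd _ _ hx hy

/-! ### The dagger operation

It is the conjugate-linear involutive anti-automorphism of `A₁` that exchanges `a` and `a†`. -/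

/-- The opposite ring of `A₁`. -/
def ConjOp : Type := A₁ᵐᵒᵖ

noncomputable instance : Ring ConjOp := inferInstanceAs (Ring A₁ᵐᵒᵖ)

/-- A scalar acts on the opposite ring through its complex conjugate. -/
noncomputable instance : Algebra ℂ ConjOp :=
  RingHom.toAlgebra' (R := ℂ) (S := ConjOp) ((algebraMap ℂ A₁ᵐᵒᵖ).comp (starRingEnd ℂ))
    fun c x => Algebra.commutes (R := ℂ) (A := A₁ᵐᵒᵖ) (starRingEnd ℂ c) x

/-- The generators, exchanged, as elements of the opposite ring. -/
noncomputable def daggerGen (g : Gen) : ConjOp := MulOpposite.op (gen g.swap)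

theorem daggerGen_comm : daggerGen Gen.ann * daggerGen Gen.cre =
    daggerGen Gen.cre * daggerGen Gen.ann + 1 :=
  congrArg MulOpposite.op a_mul_ad

/-- The dagger operation, as a ring homomorphism into the opposite ring. -/
noncomputable def daggerHom : A₁ →+* A₁ᵐᵒᵖ := (lift daggerGen daggerGen_comm).toRingHom

theorem daggerHom_gen (g : Gen) : daggerHom (gen g) = MulOpposite.op (gen g.swap) :=
  lift_gen daggerGen daggerGen_comm g

theorem daggerHom_algebraMap (c : ℂ) :
    daggerHom (algebraMap ℂ A₁ c) = MulOpposite.op (algebraMap ℂ A₁ (starRingEnd ℂ c)) :=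
  (lift daggerGen daggerGen_comm).commutes c

theorem dagger_dagger (x : A₁) : (daggerHom (daggerHom x).unop).unop = x := by
  induction x using induct with
  | hc c => simp [daggerHom_algebraMap]
  | hg g => cases g <;> simp [daggerHom_gen, Gen.swap]
  | hmul x y hx hy => simp [hx, hy]
  | hadd x y hx hy => simp [hx, hy]

/-- `star p` is `p†`. -/
noncomputable instance : StarRing A₁ where
  star x := (daggerHom x).unop
  star_involutive := dagger_dagger
  star_mul x y := by simp
  star_add x y := by simp

theorem star_a : star a = ad := congrArg MulOpposite.unop (daggerHom_gen Gen.ann)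

theorem star_ad : star ad = a := congrArg MulOpposite.unop (daggerHom_gen Gen.cre)

instance : StarModule ℂ A₁ where
  star_smul c x := by
    rw [Algebra.smul_def, star_mul, Algebra.smul_def]
    have h : star (algebraMap ℂ A₁ c) = algebraMap ℂ A₁ (star c) :=
      congrArg MulOpposite.unop (daggerHom_algebraMap c)
    rw [h]
    exact (Algebra.commutes _ _).symm

/-! ### The skew-hermitian Weyl algebra and its low-degree subspaces -/

/-- The skew-hermitian Weyl algebra `Â₁`: the real Lie algebra (under the commutator) of all
`p ∈ A₁` with `p† = -p`. -/
noncomputable def skewA₁ : LieSubalgebra ℝ A₁ where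
  carrier := {p | star p = -p}
  zero_mem' := by simp
  add_mem' {p q} hp hq := by
    change star p = -p at hp
    change star q = -q at hq
    change star (p + q) = -(p + q)
    rw [star_add, hp, hq]; abel
  smul_mem' r p hp := by
    change star p = -p at hp
    change star (r • p) = -(r • p)
    have e : r • p = (r : ℂ) • p := (algebraMap_smul ℂ r p).symm
    rw [e, star_smul, hp]
    simp
  lie_mem' {p q} hp hq := by
    change star p = -p at hp
    change star q = -q at hq
    change star ⁅p, q⁆ = -⁅p, q⁆
    rw [Ring.lie_def, star_sub, star_mul, star_mul, hp, hq]
    noncomm_ring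

/-- The free term `i a† a + i c`. -/
noncomputable def freeTerm (c : ℝ) : A₁ := Complex.I • (ad * a) + (Complex.I * (c : ℂ)) • 1

/-- `Â₁⁰`, the real span of `i` and `i a† a`. -/
noncomputable def skewA₁0 : Submodule ℝ A₁ :=
  Submodule.span ℝ {Complex.I • 1, Complex.I • (ad * a)}

/-- `Â₁¹`, the real span of `i (a + a†)` and `a - a†`. -/
noncomputable def skewA₁1 : Submodule ℝ A₁ :=
  Submodule.span ℝ {Complex.I • (a + ad), a - ad}

/-- `Â₁²`, the real span of `i (a² + (a†)²)` and `a² - (a†)²`. -/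
noncomputable def skewA₁2 : Submodule ℝ A₁ :=
  Submodule.span ℝ {Complex.I • (a ^ 2 + ad ^ 2), a ^ 2 - ad ^ 2}

/-- The Lie algebra generated by `Â₁⁰ ⊕ Â₁¹ ⊕ Â₁²`. -/
noncomputable def lieA₁le2 : LieSubalgebra ℝ A₁ :=
  LieSubalgebra.lieSpan ℝ A₁ ((skewA₁0 ⊔ skewA₁1 ⊔ skewA₁2 : Submodule ℝ A₁) : Set A₁)

/-! ### The Schrödinger algebra -/

/-- `L` is (a copy of) the real Schrödinger algebra: it has a basis `h, x, y, q, p, z` with the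
defining commutation relations. -/
def IsSchrodinger (L : Type*) [LieRing L] [LieAlgebra ℝ L] : Prop :=
  ∃ (b : Module.Basis (Fin 6) ℝ L) (h x y q p z : L), ⇑b = ![h, x, y, q, p, z] ∧
    ⁅h, x⁆ = (2 : ℝ) • x ∧ ⁅h, y⁆ = (-2 : ℝ) • y ∧ ⁅x, y⁆ = h ∧ ⁅h, q⁆ = q ∧ ⁅h, p⁆ = -p ∧
    ⁅x, q⁆ = 0 ∧ ⁅x, p⁆ = q ∧ ⁅y, q⁆ = p ∧ ⁅y, p⁆ = 0 ∧ ⁅q, p⁆ = z ∧ ∀ u : L, ⁅z, u⁆ = 0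

/-- The real Heisenberg algebra `𝔥₁`, with basis `q, p, z` and `[q, p] = z`, `z` central. -/
@[ext] structure Heis : Type where
  q : ℝ
  p : ℝ
  z : ℝ

namespace Heis

/-- Coordinates with respect to `q, p, z`. -/
def equiv : Heis ≃ ℝ × ℝ × ℝ where
  toFun v := (v.q, v.p, v.z)
  invFun v := ⟨v.1, v.2.1, v.2.2⟩
  left_inv _ := rfl
  right_inv _ := rfl

noncomputable instance : AddCommGroup Heis := equiv.addCommGroup

noncomputable instance : Module ℝ Heis := equiv.module ℝ

@[simp] theorem zero_q : (0 : Heis).q = 0 := rfl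
@[simp] theorem zero_p : (0 : Heis).p = 0 := rfl
@[simp] theorem zero_z : (0 : Heis).z = 0 := rfl
@[simp] theorem add_q (u v : Heis) : (u + v).q = u.q + v.q := rfl
@[simp] theorem add_p (u v : Heis) : (u + v).p = u.p + v.p := rfl
@[simp] theorem add_z (u v : Heis) : (u + v).z = u.z + v.z := rfl
@[simp] theorem sub_q (u v : Heis) : (u - v).q = u.q - v.q := rfl
@[simp] theorem sub_p (u v : Heis) : (u - v).p = u.p - v.p := rfl
@[simp] theorem sub_z (u v : Heis) : (u - v).z = u.z - v.z := rfl
@[simp] theorem smul_q (r : ℝ) (v : Heis) : (r • v).q = r * v.q := rfl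
@[simp] theorem smul_p (r : ℝ) (v : Heis) : (r • v).p = r * v.p := rfl
@[simp] theorem smul_z (r : ℝ) (v : Heis) : (r • v).z = r * v.z := rfl

instance : Bracket Heis Heis where
  bracket u v := ⟨0, 0, u.q * v.p - u.p * v.q⟩

@[simp] theorem lie_q (u v : Heis) : ⁅u, v⁆.q = 0 := rfl
@[simp] theorem lie_p (u v : Heis) : ⁅u, v⁆.p = 0 := rfl
@[simp] theorem lie_z (u v : Heis) : ⁅u, v⁆.z = u.q * v.p - u.p * v.q := rfl

noncomputable instance : LieRing Heis where
  add_lie u v w := by ext <;> simp; ring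
  lie_add u v w := by ext <;> simp; ring
  lie_self u := by ext <;> simp; ring
  leibniz_lie u v w := by ext <;> simp

noncomputable instance : LieAlgebra ℝ Heis where
  lie_smul r u v := by ext <;> simp; ring

end Heis

/-- The standard representation of `𝔰𝔩(2, ℝ)` on `𝔥₁` by derivations: matrices act on the
coordinate vector `(q, p)` and annihilate the centre. -/
noncomputable def sl2Act :
    LieAlgebra.SpecialLinear.sl (Fin 2) ℝ →ₗ⁅ℝ⁆ LieDerivation ℝ Heis Heis where
  toFun M :=
    { toFun := fun v => ⟨M.1 0 0 * v.q + M.1 0 1 * v.p, M.1 1 0 * v.q + M.1 1 1 * v.p, 0⟩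
      map_add' := fun u v => by ext <;> simp <;> ring
      map_smul' := fun r v => by ext <;> simp <;> ring
      leibniz' := fun u v => by
        have hM : M.1 0 0 + M.1 1 1 = 0 := by
          have h : Matrix.trace M.1 = 0 := M.2
          simpa [Matrix.trace, Fin.sum_univ_two] using h
        have h1 : M.1 1 1 = -M.1 0 0 := by linarith
        ext <;> simp [h1]; ring }
  map_add' M N := by ext v <;> simp <;> ring
  map_smul' r M := by ext v <;> simp <;> ring
  map_lie' {M N} := by
    ext v <;> simp [LieDerivation.lie_apply, Ring.lie_def, Matrix.mul_apply, Fin.sum_univ_two] <;>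
      ring

/-- The semidirect sum `𝔰𝔩(2, ℝ) ⋉ 𝔥₁`. -/
abbrev SL2Heis : Type :=
  LieAlgebra.SemiDirectSum Heis (LieAlgebra.SpecialLinear.sl (Fin 2) ℝ) sl2Act

end Weyl

/-! Write N for `num`. For the classification, replace a finite-dimensional `g` by its complex span
V, which is closed under commutators and under `star` and contains N + c. The commutator with N is
diagonalizable on the whole Weyl algebra with integer eigenvalues, the weight vectors being (a†)^k
f(N) and f(N) a^k. Hence V is spanned by the weight vectors it contains (`le_of_weight_inf_le`).
Polynomials in N commute, so a non-commutative V contains some u = (a†)^k f(N) with k > 0 and f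
nonzero (`exists_raise_mem`).

Two degree bounds then confine V. If p(N) lies in V, commuting with p(N) multiplies f by p(X + k) -
p(X). Finite dimension forces this difference to be constant, so deg p ≤ 1
(`natDegree_le_one_of_aeval_num_mem`). Next, u u† = g(N) with deg g = k + 2 deg f, and u† u = g(N +
k). Applying the first bound to [u†, u] gives k + 2 deg f ≤ 2 (`add_two_mul_natDegree_le_two`). So V
consists of elements of degree at most two, and the skew-hermitian ones among these are exactly the
given direct sum. The eigenvectors N + c, u, u† have distinct weights 0, k, -k, which gives
dimension at least three.

For the structure statement, six explicit skew-hermitian quadratics satisfy the Schrödinger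
relations. Their span is therefore already closed under brackets and equals the generated algebra.
The semidirect sum has a basis with the same structure constants, and equal structure constants give
an isomorphism (`IsSchrodinger.nonempty_lieEquiv`). -/

namespace Weyl

open Polynomial

/-! ### The number operator -/

/-- The number operator `a† a`. -/
noncomputable def num : A₁ := ad * a

theorem semiconj_ad_pow (k : ℕ) : SemiconjBy (ad ^ k) (num + k) num := by
  induction k with
  | zero => simp
  | succ k ih =>
    unfold SemiconjBy at *
    have h : ad * (num + 1) = num * ad := by
      simp only [num, mul_assoc, a_mul_ad]
    calc ad ^ (k + 1) * (num + ((k + 1 : ℕ) : A₁))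
        = ad * (ad ^ k * (num + k)) + ad * ad ^ k := by
          rw [pow_succ']; push_cast; noncomm_ring
      _ = ad * (num + 1) * ad ^ k := by rw [ih]; noncomm_ring
      _ = num * ad ^ (k + 1) := by rw [h, pow_succ', mul_assoc]

theorem aeval_num_taylor (f : ℂ[X]) (r : ℂ) :
    aeval num (taylor r f) = aeval (num + algebraMap ℂ A₁ r) f := by
  rw [taylor_apply, aeval_comp]; simp

theorem semiconjBy_aeval {x y z : A₁} (h : SemiconjBy x y z) (f : ℂ[X]) :
    SemiconjBy x (aeval y f) (aeval z f) := by
  induction f using Polynomial.induction_on' with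
  | add f g hf hg => simpa using hf.add_right hg
  | monomial n c =>
    rw [aeval_monomial, aeval_monomial]
    exact SemiconjBy.mul_right (Algebra.commutes c x).symm (h.pow_right n)

/-- Polynomials in the number operator move past powers of `a†` by a shift of the argument. -/
theorem aeval_num_mul_ad_pow (f : ℂ[X]) (k : ℕ) :
    aeval num f * ad ^ k = ad ^ k * aeval num (taylor (k : ℂ) f) := by
  rw [aeval_num_taylor, map_natCast]
  exact (semiconjBy_aeval (semiconj_ad_pow k) f).symm

theorem aeval_num_mul_ad (f : ℂ[X]) :
    aeval num f * ad = ad * aeval num (taylor 1 f) := by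
  simpa using aeval_num_mul_ad_pow f 1

theorem ad_mul_aeval_num (f : ℂ[X]) :
    ad * aeval num f = aeval num (taylor (-1) f) * ad := by
  rw [aeval_num_mul_ad, taylor_taylor]; simp

theorem a_mul_aeval_num (f : ℂ[X]) :
    a * aeval num f = aeval num (taylor 1 f) * a := by
  rw [aeval_num_taylor, map_one]
  refine semiconjBy_aeval (?_ : a * num = (num + 1) * a) f
  rw [num, ← mul_assoc, a_mul_ad]

theorem ad_mul_aeval_num_mul_a (f : ℂ[X]) :
    ad * aeval num f * a = aeval num (taylor (-1) f * X) := by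
  rw [ad_mul_aeval_num, map_mul, aeval_X, num, mul_assoc]

theorem a_mul_aeval_num_mul_ad (f : ℂ[X]) :
    a * aeval num f * ad = aeval num ((X + 1) * taylor 1 f) := by
  rw [mul_assoc, aeval_num_mul_ad, ← mul_assoc, a_mul_ad]
  simp [num]

/-- Each layer a† · a shifts the argument by -1 and contributes one factor N, so the degree grows by
exactly one per layer. -/
theorem exists_ad_pow_mul_aeval_num_mul_a_pow (k : ℕ) (f : ℂ[X]) (hf : f ≠ 0) :
    ∃ g : ℂ[X], g ≠ 0 ∧ g.natDegree = k + f.natDegree ∧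
      ad ^ k * aeval num f * a ^ k = aeval num g := by
  induction k with
  | zero => exact ⟨f, hf, by simp, by simp⟩
  | succ k ih =>
    obtain ⟨g, hg, hd, h⟩ := ih
    have h0 : taylor (-1) g ≠ 0 := by simpa [taylor_eq_zero] using hg
    refine ⟨taylor (-1) g * X, mul_ne_zero h0 X_ne_zero, ?_, ?_⟩
    · rw [natDegree_mul_X h0, natDegree_taylor, hd]; ring
    · rw [← ad_mul_aeval_num_mul_a, ← h, pow_succ', pow_succ]
      simp only [mul_assoc]

/-- No degree is recorded here: in its application the resulting polynomial is identified by
associativity. -/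
theorem exists_a_pow_mul_aeval_num_mul_ad_pow (k : ℕ) (f : ℂ[X]) :
    ∃ g : ℂ[X], a ^ k * aeval num f * ad ^ k = aeval num g := by
  induction k with
  | zero => exact ⟨f, by simp⟩
  | succ k ih =>
    obtain ⟨g, h⟩ := ih
    refine ⟨(X + 1) * taylor 1 g, ?_⟩
    rw [← a_mul_aeval_num_mul_ad, ← h, pow_succ', pow_succ]
    simp only [mul_assoc]

/-! ### A faithful action on bilateral sequences -/

/-- The images of the generators as operators on bilateral sequences. -/
noncomputable def seqGen : Gen → Module.End ℂ (ℤ → ℂ)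
  | Gen.ann =>
    { toFun := fun φ n => ((n : ℂ) + 1) * φ (n + 1)
      map_add' := fun φ ψ => by ext n; simp [mul_add]
      map_smul' := fun c φ => by ext n; simp; ring }
  | Gen.cre =>
    { toFun := fun φ n => φ (n - 1)
      map_add' := fun φ ψ => by ext n; simp
      map_smul' := fun c φ => by ext n; simp }

theorem seqGen_comm : seqGen Gen.ann * seqGen Gen.cre = seqGen Gen.cre * seqGen Gen.ann + 1 := by
  ext φ n
  simp [seqGen]
  ring

/-- The action of the Weyl algebra on bilateral sequences. -/
noncomputable def seqRep : A₁ →ₐ[ℂ] Module.End ℂ (ℤ → ℂ) := lift seqGen seqGen_comm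

theorem seqRep_a (φ : ℤ → ℂ) (n : ℤ) : seqRep a φ n = ((n : ℂ) + 1) * φ (n + 1) := by
  rw [seqRep, a, lift_gen]; rfl

theorem seqRep_ad (φ : ℤ → ℂ) (n : ℤ) : seqRep ad φ n = φ (n - 1) := by
  rw [seqRep, ad, lift_gen]; rfl

theorem seqRep_num (φ : ℤ → ℂ) (n : ℤ) : seqRep num φ n = (n : ℂ) * φ n := by
  rw [num, map_mul, Module.End.mul_apply, seqRep_ad, seqRep_a]
  simp

theorem seqRep_ad_pow (k : ℕ) (φ : ℤ → ℂ) (n : ℤ) : seqRep (ad ^ k) φ n = φ (n - k) := by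
  induction k generalizing n with
  | zero => simp
  | succ k ih =>
    rw [pow_succ', map_mul, Module.End.mul_apply, seqRep_ad, ih]
    congr 1; push_cast; ring

theorem seqRep_aeval_num (f : ℂ[X]) (φ : ℤ → ℂ) (n : ℤ) :
    seqRep (aeval num f) φ n = f.eval (n : ℂ) * φ n := by
  induction f using Polynomial.induction_on' with
  | add f g hf hg => simp [hf, hg, add_mul]
  | monomial m c =>
    have h : ∀ m : ℕ, seqRep (num ^ m) φ n = (n : ℂ) ^ m * φ n := by
      intro m
      induction m with
      | zero => simp
      | succ m ih =>
        rw [pow_succ', map_mul, Module.End.mul_apply, seqRep_num, ih]; ring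
    rw [aeval_monomial, ← Algebra.smul_def, map_smul, LinearMap.smul_apply, Pi.smul_apply, h]
    simp [mul_assoc]

theorem eq_zero_of_eval_int {f : ℂ[X]} (h : ∀ n : ℤ, f.eval (n : ℂ) = 0) : f = 0 := by
  refine Polynomial.eq_zero_of_infinite_isRoot f
    ((Set.infinite_range_of_injective (Int.cast_injective (α := ℂ))).mono ?_)
  rintro _ ⟨n, rfl⟩
  exact h n

theorem ad_pow_mul_aeval_num_eq_zero {k : ℕ} {f : ℂ[X]} (h : ad ^ k * aeval num f = 0) :
    f = 0 := by
  refine eq_zero_of_eval_int fun n => ?_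
  -- On the constant sequence the value at n + k is f(n), so f vanishes at every integer.
  have h1 : seqRep (ad ^ k * aeval num f) (fun _ => 1) (n + k) = 0 := by rw [h]; simp
  rw [map_mul, Module.End.mul_apply, seqRep_ad_pow, seqRep_aeval_num] at h1
  simpa using h1

/-- The weight vector `(a†)ᵏ f(a†a)`, as a linear function of `f`. -/
noncomputable def raise (k : ℕ) : ℂ[X] →ₗ[ℂ] A₁ :=
  LinearMap.mulLeft ℂ (ad ^ k) ∘ₗ (aeval num).toLinearMap

theorem raise_apply (k : ℕ) (f : ℂ[X]) : raise k f = ad ^ k * aeval num f := rfl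

theorem raise_injective (k : ℕ) : Function.Injective (raise k) :=
  (injective_iff_map_eq_zero _).2 fun _ h => ad_pow_mul_aeval_num_eq_zero h

/-! ### Dagger of weight vectors -/

theorem star_num : star num = num := by rw [num, star_mul, star_a, star_ad]

theorem star_algebraMap (c : ℂ) : star (algebraMap ℂ A₁ c) = algebraMap ℂ A₁ (star c) := by
  rw [Algebra.algebraMap_eq_smul_one, star_smul, star_one, ← Algebra.algebraMap_eq_smul_one]

theorem star_aeval_num (f : ℂ[X]) :
    star (aeval num f) = aeval num (f.map (starRingEnd ℂ)) := by
  induction f using Polynomial.induction_on' with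
  | add f g hf hg => simp [hf, hg]
  | monomial n c =>
    rw [map_monomial, aeval_monomial, aeval_monomial, star_mul, star_pow, star_num,
      star_algebraMap]
    exact (Algebra.commutes _ _).symm

theorem star_raise (k : ℕ) (f : ℂ[X]) :
    star (raise k f) = aeval num (f.map (starRingEnd ℂ)) * a ^ k := by
  rw [raise_apply, star_mul, star_pow, star_ad, star_aeval_num]

/-! ### Finite differences of polynomials -/

/-- A periodic polynomial takes its value at 0 at all multiples of the period. -/
theorem natDegree_eq_zero_of_taylor_eq_self {k : ℕ} (hk : k ≠ 0) {f : ℂ[X]}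
    (h : taylor (k : ℂ) f = f) : f.natDegree = 0 := by
  have h1 : ∀ n : ℕ, f.eval ((n * k : ℕ) : ℂ) = f.eval 0 := by
    intro n
    induction n with
    | zero => simp
    | succ n ih =>
      rw [← ih]
      conv_rhs => rw [← h, taylor_eval]
      congr 1; push_cast; ring
  have h2 : f - C (f.eval 0) = 0 := by
    refine Polynomial.eq_zero_of_infinite_isRoot _
      ((Set.infinite_range_of_injective (f := fun n : ℕ => ((n * k : ℕ) : ℂ)) ?_).mono ?_)
    · intro m n hmn
      exact Nat.eq_of_mul_eq_mul_right (Nat.pos_of_ne_zero hk) (Nat.cast_injective hmn)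
    · rintro _ ⟨n, rfl⟩
      simp [-Nat.cast_mul, h1]
  rw [sub_eq_zero.1 h2, natDegree_C]

/-- Differencing lowers the degree by only one. Differentiation commutes with the shift, so
induction on m passes to the derivative; at m = 0 the derivative is periodic. -/
theorem natDegree_le_of_natDegree_taylor_sub_le {k : ℕ} (hk : k ≠ 0) (m : ℕ) (f : ℂ[X])
    (h : (taylor (k : ℂ) f - f).natDegree ≤ m) : f.natDegree ≤ m + 1 := by
  have hder : ∀ g : ℂ[X], derivative (taylor (k : ℂ) g) = taylor (k : ℂ) (derivative g) := by
    intro g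
    simp [taylor_apply, derivative_comp]
  induction m generalizing f with
  | zero =>
    have h1 : derivative (taylor (k : ℂ) f - f) = 0 :=
      derivative_of_natDegree_zero (Nat.le_zero.1 h)
    rw [derivative_sub, hder, sub_eq_zero] at h1
    have h2 := natDegree_eq_zero_of_taylor_eq_self hk h1
    rw [natDegree_derivative] at h2
    omega
  | succ m ih =>
    have h1 := ih (derivative f) (by
      rw [← hder, ← derivative_sub, natDegree_derivative]; omega)
    rw [natDegree_derivative] at h1
    omega

/-! ### The weight decomposition -/

/-- The weight vector `f(a†a) aᵏ`, as a linear function of `f`. -/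
noncomputable def lower (k : ℕ) : ℂ[X] →ₗ[ℂ] A₁ :=
  LinearMap.mulRight ℂ (a ^ k) ∘ₗ (aeval num).toLinearMap

theorem lower_apply (k : ℕ) (f : ℂ[X]) : lower k f = aeval num f * a ^ k := rfl

theorem star_raise_eq_lower (k : ℕ) (f : ℂ[X]) :
    star (raise k f) = lower k (f.map (starRingEnd ℂ)) := star_raise k f

theorem star_lower (k : ℕ) (f : ℂ[X]) :
    star (lower k f) = raise k (f.map (starRingEnd ℂ)) := by
  rw [lower_apply, star_mul, star_pow, star_a, star_aeval_num, raise_apply]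

/-- The commutator with the number operator. -/
noncomputable def adNum : Module.End ℂ A₁ := LinearMap.mulLeft ℂ num - LinearMap.mulRight ℂ num

theorem adNum_apply (x : A₁) : adNum x = num * x - x * num := rfl

theorem commute_aeval_num (f g : ℂ[X]) : aeval num f * aeval num g = aeval num g * aeval num f := by
  rw [← map_mul, ← map_mul, mul_comm]

theorem adNum_raise (k : ℕ) (f : ℂ[X]) : adNum (raise k f) = (k : ℂ) • raise k f := by
  have h := (semiconj_ad_pow k).eq
  have h2 := commute_aeval_num X f
  rw [aeval_X] at h2
  rw [adNum_apply, raise_apply, ← mul_assoc, ← h, mul_assoc, mul_assoc, add_mul, h2, mul_add,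
    add_sub_cancel_left, ← map_natCast (algebraMap ℂ A₁), ← Algebra.smul_def, mul_smul_comm]

theorem star_adNum (x : A₁) : star (adNum x) = -adNum (star x) := by
  rw [adNum_apply, adNum_apply, star_sub, star_mul, star_mul, star_num]; abel

theorem adNum_lower (k : ℕ) (f : ℂ[X]) : adNum (lower k f) = (-(k : ℂ)) • lower k f := by
  have h := congrArg star (adNum_raise k (f.map (starRingEnd ℂ)))
  have h2 : (f.map (starRingEnd ℂ)).map (starRingEnd ℂ) = f := by
    ext n; simp
  rw [star_adNum, star_smul, star_raise_eq_lower, h2] at h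
  rw [← neg_neg (adNum _), h]
  simp

/-- The vectors of weight `k`. -/
noncomputable def weight : ℤ → Submodule ℂ A₁
  | Int.ofNat k => LinearMap.range (raise k)
  | Int.negSucc k => LinearMap.range (lower (k + 1))

theorem adNum_of_mem_weight {k : ℤ} {x : A₁} (hx : x ∈ weight k) : adNum x = (k : ℂ) • x := by
  cases k with
  | ofNat k =>
    obtain ⟨f, rfl⟩ := hx
    simpa using adNum_raise k f
  | negSucc k =>
    obtain ⟨f, rfl⟩ := hx
    simpa [Int.negSucc_eq] using adNum_lower (k + 1) f

theorem raise_mem_iSup_weight (k : ℕ) (f : ℂ[X]) : raise k f ∈ ⨆ k, weight k :=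
  Submodule.mem_iSup_of_mem (k : ℤ) ⟨f, rfl⟩

theorem lower_mem_iSup_weight (k : ℕ) (f : ℂ[X]) : lower k f ∈ ⨆ k, weight k := by
  cases k with
  | zero =>
    have h : lower 0 f = raise 0 f := by simp [lower_apply, raise_apply]
    rw [h]
    exact raise_mem_iSup_weight 0 f
  | succ k => exact Submodule.mem_iSup_of_mem (Int.negSucc k) ⟨f, rfl⟩

/-- Generators move weight vectors to adjacent weights. It follows that the sum of the weight spaces
is a left ideal; it contains 1, so it is everything. -/
theorem gen_mul_mem_iSup_weight (g : Gen) {y : A₁} (hy : y ∈ ⨆ k, weight k) :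
    gen g * y ∈ ⨆ k, weight k := by
  induction hy using Submodule.iSup_induction' with
  | zero => simp
  | add x y _ _ hx hy => rw [mul_add]; exact add_mem hx hy
  | mem k x hx =>
    cases k with
    | ofNat k =>
      obtain ⟨f, rfl⟩ := hx
      cases g with
      | ann =>
        change a * _ ∈ _
        cases k with
        | zero =>
          have h : a * raise 0 f = lower 1 (taylor 1 f) := by
            simp [raise_apply, lower_apply, a_mul_aeval_num]
          rw [h]; exact lower_mem_iSup_weight _ _
        | succ k =>
          have h : a * raise (k + 1) f = raise k (taylor (k : ℂ) (X + 1) * f) := by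
            rw [raise_apply, raise_apply, map_mul, ← mul_assoc (ad ^ k), ← aeval_num_mul_ad_pow,
              pow_succ', ← mul_assoc, ← mul_assoc, a_mul_ad]
            simp [num]
          rw [h]; exact raise_mem_iSup_weight _ _
      | cre =>
        change ad * _ ∈ _
        have h : ad * raise k f = raise (k + 1) f := by
          rw [raise_apply, raise_apply, pow_succ', mul_assoc]
        rw [h]; exact raise_mem_iSup_weight _ _
    | negSucc k =>
      obtain ⟨f, rfl⟩ := hx
      cases g with
      | ann =>
        change a * _ ∈ _
        have h : a * lower (k + 1) f = lower (k + 2) (taylor 1 f) := by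
          rw [lower_apply, lower_apply, ← mul_assoc, a_mul_aeval_num, mul_assoc, ← pow_succ']
        rw [h]; exact lower_mem_iSup_weight _ _
      | cre =>
        change ad * _ ∈ _
        have h : ad * lower (k + 1) f = lower k (taylor (-1) f * X) := by
          rw [lower_apply, lower_apply, ← ad_mul_aeval_num_mul_a, pow_succ']
          simp only [mul_assoc]
        rw [h]; exact lower_mem_iSup_weight _ _

theorem iSup_weight : ⨆ k, weight k = ⊤ := by
  rw [eq_top_iff]
  rintro x -
  have h : ∀ x y : A₁, y ∈ ⨆ k, weight k → x * y ∈ ⨆ k, weight k := by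
    intro x
    induction x using induct with
    | hc c =>
      intro y hy
      rw [← Algebra.smul_def]
      exact Submodule.smul_mem _ c hy
    | hg g => exact fun y hy => gen_mul_mem_iSup_weight g hy
    | hmul u v hu hv =>
      intro y hy
      rw [mul_assoc]
      exact hu _ (hv _ hy)
    | hadd u v hu hv =>
      intro y hy
      rw [add_mul]
      exact add_mem (hu _ hy) (hv _ hy)
  have h1 : (1 : A₁) ∈ ⨆ k, weight k := by
    have := raise_mem_iSup_weight 0 1
    simpa [raise_apply] using this
  simpa using h x 1 h1

/-- A subspace that is stable under the commutator with the number operator is spanned by the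
weight vectors that it contains. -/
theorem le_of_weight_inf_le {V T : Submodule ℂ A₁} (hV : ∀ x ∈ V, adNum x ∈ V)
    (h : ∀ k, V ⊓ weight k ≤ T) : V ≤ T := by
  intro x hx
  have hxt : x ∈ ⨆ k, weight k := by rw [iSup_weight]; trivial
  obtain ⟨m, hm, hsum⟩ := (Submodule.mem_iSup_iff_exists_finsupp _ _).1 hxt
  rw [← hsum]
  refine Submodule.sum_mem _ fun k hk => h k ⟨?_, hm k⟩
  have haeval : ∀ (p : ℂ[X]) (y : A₁) (μ : ℂ), adNum y = μ • y →
      aeval adNum p y = p.eval μ • y := by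
    intro p y μ hy
    induction p using Polynomial.induction_on' with
    | add p q hp hq => simp [hp, hq, add_smul]
    | monomial n c =>
      have hpow : (adNum ^ n) y = μ ^ n • y := by
        induction n with
        | zero => simp
        | succ n ih => rw [pow_succ', Module.End.mul_apply, ih, map_smul, hy, smul_smul, pow_succ]
      simp [aeval_monomial, hpow, smul_smul, mul_comm]
  have hstable : ∀ p : ℂ[X], aeval adNum p x ∈ V := by
    intro p
    induction p using Polynomial.induction_on' with
    | add p q hp hq => rw [map_add]; exact add_mem hp hq
    | monomial n c =>
      have hpow : (adNum ^ n) x ∈ V := by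
        induction n with
        | zero => simpa
        | succ n ih => rw [pow_succ', Module.End.mul_apply]; exact hV _ ih
      rw [aeval_monomial, Module.End.mul_apply]
      exact Submodule.smul_mem _ c hpow
  -- The Lagrange polynomial that is 1 at k and 0 at the other occurring weights, evaluated at
  -- `adNum`, projects x onto its component of weight k.
  have hL := hstable (Lagrange.basis m.support (fun j : ℤ => (j : ℂ)) k)
  rw [← hsum, Finsupp.sum, map_sum, Finset.sum_eq_single k] at hL
  · rwa [haeval _ _ _ (adNum_of_mem_weight (hm k)),
      Lagrange.eval_basis_self (fun _ _ _ _ h => Int.cast_injective h) hk, one_smul] at hL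
  · intro j hj hjk
    rw [haeval _ _ _ (adNum_of_mem_weight (hm j)), Lagrange.eval_basis_of_ne hjk.symm hj, zero_smul]
  · exact fun h => (h hk).elim

/-! ### Finite-dimensional commutator-closed subspaces -/

theorem commutator_aeval_num_raise (p f : ℂ[X]) (k : ℕ) :
    aeval num p * raise k f - raise k f * aeval num p = raise k ((taylor (k : ℂ) p - p) * f) := by
  rw [raise_apply, raise_apply, ← mul_assoc, aeval_num_mul_ad_pow, mul_assoc, mul_assoc,
    ← map_mul, ← map_mul, ← mul_sub, ← map_sub, sub_mul, mul_comm f p]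

/-- The polynomials u with `raise k u` in V form a nonzero finite-dimensional space stable under
multiplication by d. An eigenvector satisfies d u = μ u, and cancelling u makes d constant. -/
theorem natDegree_le_one_of_aeval_num_mem {V : Submodule ℂ A₁} [FiniteDimensional ℂ V]
    (hlie : ∀ x ∈ V, ∀ y ∈ V, x * y - y * x ∈ V) {k : ℕ} (hk : k ≠ 0) {f p : ℂ[X]} (hf : f ≠ 0)
    (hfV : raise k f ∈ V) (hp : aeval num p ∈ V) : p.natDegree ≤ 1 := by
  set d := taylor (k : ℂ) p - p with hd
  let U : Submodule ℂ ℂ[X] := V.comap (raise k)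
  have hU : FiniteDimensional ℂ U := by
    let φ : U →ₗ[ℂ] V := (raise k).restrict fun _ h => h
    refine Module.Finite.of_injective φ fun u v huv => Subtype.ext (raise_injective k ?_)
    exact congrArg Subtype.val huv
  have hmul : ∀ u ∈ U, LinearMap.mulLeft ℂ d u ∈ U := by
    intro u hu
    change raise k (d * u) ∈ V
    rw [hd, ← commutator_aeval_num_raise]
    exact hlie _ hp _ hu
  have hnt : Nontrivial U := ⟨⟨⟨f, hfV⟩, 0, fun h => hf (congrArg Subtype.val h)⟩⟩
  obtain ⟨μ, hμ⟩ := Module.End.exists_eigenvalue ((LinearMap.mulLeft ℂ d).restrict hmul)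
  obtain ⟨u, hu⟩ := hμ.exists_hasEigenvector
  have h1 : d * (u : ℂ[X]) = C μ * u := by
    have := congrArg Subtype.val hu.apply_eq_smul
    rw [← smul_eq_C_mul]
    exact this
  have h2 : d = C μ := mul_right_cancel₀ (fun h => hu.2 (Subtype.ext h)) h1
  exact natDegree_le_of_natDegree_taylor_sub_le hk 0 p (by rw [← hd, h2, natDegree_C])

theorem add_two_mul_natDegree_le_two {V : Submodule ℂ A₁} [FiniteDimensional ℂ V]
    (hlie : ∀ x ∈ V, ∀ y ∈ V, x * y - y * x ∈ V) (hstar : ∀ x ∈ V, star x ∈ V) {k : ℕ} (hk : k ≠ 0)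
    {f : ℂ[X]} (hf : f ≠ 0) (hfV : raise k f ∈ V) : k + 2 * f.natDegree ≤ 2 := by
  set fc := f.map (starRingEnd ℂ) with hfc
  have hfc0 : fc ≠ 0 := by simpa [hfc, Polynomial.map_eq_zero] using hf
  obtain ⟨g, hg, hgd, hgk⟩ := exists_ad_pow_mul_aeval_num_mul_a_pow k (f * fc) (mul_ne_zero hf hfc0)
  obtain ⟨r, hr⟩ := exists_a_pow_mul_aeval_num_mul_ad_pow k 1
  have h1 : raise k f * star (raise k f) = aeval num g := by
    rw [← hgk, star_raise, raise_apply, map_mul]; simp only [mul_assoc]; rfl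
  have h2 : star (raise k f) * raise k f = aeval num (fc * r * f) := by
    rw [map_mul, map_mul, ← hr, star_raise, raise_apply, map_one, mul_one]
    simp only [mul_assoc]; rfl
  -- Associativity u (u† u) = (u u†) u, together with injectivity of `raise k`, identifies u† u as
  -- g(N + k) without any closed form.
  have h3 : fc * r * f = taylor (k : ℂ) g := by
    have h4 : raise k (f * (fc * r * f)) = raise k (f * taylor (k : ℂ) g) := by
      calc raise k (f * (fc * r * f)) = raise k f * (star (raise k f) * raise k f) := by
            rw [h2, raise_apply, raise_apply, map_mul _ f, mul_assoc (ad ^ k)]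
        _ = aeval num g * raise k f := by rw [← mul_assoc, h1]
        _ = raise k (f * taylor (k : ℂ) g) := by
            rw [raise_apply, ← mul_assoc, aeval_num_mul_ad_pow, mul_assoc, ← map_mul,
              mul_comm f, raise_apply]
    exact mul_left_cancel₀ hf (raise_injective k h4)
  have h5 : aeval num (taylor (k : ℂ) g - g) ∈ V := by
    rw [map_sub, ← h3, ← h2, ← h1]
    exact hlie _ (hstar _ hfV) _ hfV
  have h6 := natDegree_le_of_natDegree_taylor_sub_le hk 1 g
    (natDegree_le_one_of_aeval_num_mem hlie hk hf hfV h5)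
  have h7 : fc.natDegree = f.natDegree := by rw [hfc, natDegree_map]
  rw [hgd, natDegree_mul hf hfc0, h7] at h6
  omega

/-- The complex span of the monomials of degree at most two. -/
noncomputable def quadratic : Submodule ℂ A₁ :=
  Submodule.span ℂ {1, num, a, ad, a ^ 2, ad ^ 2}

theorem star_mem_quadratic {x : A₁} (hx : x ∈ quadratic) : star x ∈ quadratic := by
  induction hx using Submodule.span_induction with
  | mem x hx =>
    refine Submodule.subset_span ?_
    simp only [Set.mem_insert_iff, Set.mem_singleton_iff] at hx ⊢
    rcases hx with rfl | rfl | rfl | rfl | rfl | rfl <;>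
      simp [star_num, star_a, star_ad]
  | zero => simp
  | add x y _ _ hx hy => rw [star_add]; exact add_mem hx hy
  | smul c x _ hx => rw [star_smul]; exact Submodule.smul_mem _ _ hx

theorem raise_mem_quadratic {k : ℕ} {f : ℂ[X]} (h : k + 2 * f.natDegree ≤ 2) :
    raise k f ∈ quadratic := by
  have h1 : (1 : A₁) ∈ quadratic := Submodule.subset_span (by simp)
  have h2 : num ∈ quadratic := Submodule.subset_span (by simp)
  have h3 : ad ∈ quadratic := Submodule.subset_span (by simp)
  have h4 : ad ^ 2 ∈ quadratic := Submodule.subset_span (by simp)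
  rw [raise_apply, eq_X_add_C_of_natDegree_le_one (p := f) (by omega), map_add, map_mul, aeval_C,
    aeval_C, aeval_X, ← Algebra.smul_def, Algebra.algebraMap_eq_smul_one]
  by_cases hk : k = 0
  · subst hk
    rw [pow_zero, one_mul]
    exact add_mem (Submodule.smul_mem _ _ h2) (Submodule.smul_mem _ _ h1)
  · rw [coeff_eq_zero_of_natDegree_lt (p := f) (n := 1) (by omega), zero_smul, zero_add,
      mul_smul_comm, mul_one]
    refine Submodule.smul_mem _ _ ?_
    obtain rfl | rfl : k = 1 ∨ k = 2 := by omega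
    · simpa using h3
    · exact h4

/-! ### Complex subspaces closed under commutator and dagger that contain `num + c` -/

theorem adNum_mem {V : Submodule ℂ A₁} (hlie : ∀ x ∈ V, ∀ y ∈ V, x * y - y * x ∈ V)
    {c : ℂ} (hnum : num + c • 1 ∈ V) {x : A₁} (hx : x ∈ V) : adNum x ∈ V := by
  have h := hlie _ hnum _ hx
  rwa [add_mul, mul_add, smul_mul_assoc, mul_smul_comm, one_mul, mul_one,
    add_sub_add_right_eq_sub] at h

theorem exists_raise_mem {V : Submodule ℂ A₁} (hlie : ∀ x ∈ V, ∀ y ∈ V, x * y - y * x ∈ V)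
    (hstar : ∀ x ∈ V, star x ∈ V) {c : ℂ} (hnum : num + c • 1 ∈ V)
    (hcomm : ∃ x ∈ V, ∃ y ∈ V, x * y ≠ y * x) :
    ∃ k : ℕ, k ≠ 0 ∧ ∃ f : ℂ[X], f ≠ 0 ∧ raise k f ∈ V := by
  by_contra! hne
  -- Otherwise only weight zero occurs, since dagger turns a negative weight into a positive one;
  -- then V would be commutative.
  have hle : V ≤ LinearMap.range (raise 0) := by
    refine le_of_weight_inf_le (fun x => adNum_mem hlie hnum) ?_
    rintro k x ⟨hxV, hx⟩
    cases k with
    | ofNat k =>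
      obtain ⟨f, rfl⟩ := hx
      by_cases hk : k = 0
      · subst hk; exact ⟨f, rfl⟩
      · by_cases hf : f = 0
        · simp [hf]
        · exact (hne k hk f hf hxV).elim
    | negSucc k =>
      obtain ⟨f, rfl⟩ := hx
      by_cases hf : f = 0
      · simp [hf]
      · refine (hne (k + 1) k.succ_ne_zero (f.map (starRingEnd ℂ)) ?_ ?_).elim
        · simpa [Polynomial.map_eq_zero] using hf
        · rw [← star_lower]; exact hstar _ hxV
  obtain ⟨x, hx, y, hy, hxy⟩ := hcomm
  obtain ⟨f, rfl⟩ := hle hx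
  obtain ⟨g, rfl⟩ := hle hy
  refine hxy ?_
  simpa [raise_apply] using commute_aeval_num f g

theorem le_quadratic {V : Submodule ℂ A₁} [FiniteDimensional ℂ V]
    (hlie : ∀ x ∈ V, ∀ y ∈ V, x * y - y * x ∈ V)
    (hstar : ∀ x ∈ V, star x ∈ V) {c : ℂ} (hnum : num + c • 1 ∈ V)
    (hcomm : ∃ x ∈ V, ∃ y ∈ V, x * y ≠ y * x) : V ≤ quadratic := by
  -- This vector of nonzero weight is what bounds the degree of the weight-zero elements.
  obtain ⟨m, hm, e, he, heV⟩ := exists_raise_mem hlie hstar hnum hcomm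
  have hraise : ∀ (k : ℕ) (f : ℂ[X]), raise k f ∈ V → raise k f ∈ quadratic := by
    intro k f hfV
    by_cases hk : k = 0
    · subst hk
      have h := natDegree_le_one_of_aeval_num_mem hlie hm he heV
        (p := f) (by simpa [raise_apply] using hfV)
      exact raise_mem_quadratic (by omega)
    · by_cases hf : f = 0
      · simp [hf]
      · exact raise_mem_quadratic (add_two_mul_natDegree_le_two hlie hstar hk hf hfV)
  refine le_of_weight_inf_le (fun x => adNum_mem hlie hnum) ?_
  rintro k x ⟨hxV, hx⟩
  cases k with
  | ofNat k =>
    obtain ⟨f, rfl⟩ := hx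
    exact hraise k f hxV
  | negSucc k =>
    obtain ⟨f, rfl⟩ := hx
    have h := hstar _ hxV
    rw [star_lower] at h
    have h' := star_mem_quadratic (hraise _ _ h)
    rwa [← star_lower, star_star] at h'

theorem three_le_finrank {V : Submodule ℂ A₁} [FiniteDimensional ℂ V]
    (hlie : ∀ x ∈ V, ∀ y ∈ V, x * y - y * x ∈ V)
    (hstar : ∀ x ∈ V, star x ∈ V) {c : ℂ} (hnum : num + c • 1 ∈ V)
    (hcomm : ∃ x ∈ V, ∃ y ∈ V, x * y ≠ y * x) :
    3 ≤ Module.finrank ℂ V := by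
  obtain ⟨k, hk, f, hf, hfV⟩ := exists_raise_mem hlie hstar hnum hcomm
  have hk' : (k : ℂ) ≠ 0 := Nat.cast_ne_zero.2 hk
  have hne : raise k f ≠ 0 := fun h => hf (raise_injective k (by simpa using h))
  have hnum0 : num + c • 1 ≠ 0 := by
    intro h
    have h1 : raise 0 (X + C c) = raise 0 0 := by
      simpa [raise_apply, Algebra.algebraMap_eq_smul_one] using h
    exact X_add_C_ne_zero c (raise_injective 0 h1)
  have hli : LinearIndependent ℂ ![num + c • 1, raise k f, star (raise k f)] := by
    refine Module.End.eigenvectors_linearIndependent' adNum ![0, (k : ℂ), -(k : ℂ)] ?_ _ ?_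
    · intro i j
      fin_cases i <;> fin_cases j <;> simp [hk', hk'.symm, self_eq_neg, neg_eq_self]
    · intro i
      rw [Module.End.hasEigenvector_iff, Module.End.mem_eigenspace_iff]
      fin_cases i
      · exact ⟨by simp [adNum_apply, mul_add, add_mul], hnum0⟩
      · exact ⟨adNum_raise k f, hne⟩
      · refine ⟨?_, by simpa using hne⟩
        change adNum (star (raise k f)) = _
        rw [star_raise_eq_lower, adNum_lower]; rfl
  have hli' : LinearIndependent ℂ
      (![⟨_, hnum⟩, ⟨_, hfV⟩, ⟨_, hstar _ hfV⟩] : Fin 3 → V) := by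
    refine LinearIndependent.of_comp V.subtype ?_
    convert hli using 1
    ext i
    fin_cases i <;> rfl
  simpa using hli'.fintype_card_le_finrank

/-! ### Linear independence of the monomials of degree at most two -/

theorem coeff_eq_zero_of_quadratic_eq_zero {c₀ c₁ c₂ c₃ c₄ c₅ : ℂ}
    (h : c₀ • 1 + c₁ • num + c₂ • a + c₃ • ad + c₄ • a ^ 2 + c₅ • ad ^ 2 = 0) :
    c₀ = 0 ∧ c₁ = 0 ∧ c₂ = 0 ∧ c₃ = 0 ∧ c₄ = 0 ∧ c₅ = 0 := by
  have key : ∀ (φ : ℤ → ℂ) (n : ℤ), c₀ * φ n + c₁ * (n * φ n) + c₂ * ((n + 1) * φ (n + 1)) +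
      c₃ * φ (n - 1) + c₄ * ((n + 1) * ((n + 2) * φ (n + 2))) + c₅ * φ (n - 2) = 0 := by
    intro φ n
    have h1 := congrFun (congrArg (fun x => seqRep x φ) h) n
    simp only [map_add, map_smul, map_one, map_zero, LinearMap.add_apply, LinearMap.smul_apply,
      Pi.add_apply, Pi.smul_apply, Module.End.one_apply, seqRep_num, seqRep_a, seqRep_ad,
      LinearMap.zero_apply, Pi.zero_apply, smul_eq_mul, pow_two, map_mul, Module.End.mul_apply] at h1
    rw [show n - 1 - 1 = n - 2 by ring, show n + 1 + 1 = n + 2 by ring] at h1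
    rw [← h1]; push_cast; ring
  -- Matrix entries on delta sequences: each isolates one coefficient up to a nonzero factor, except
  -- `e1`, which gives c₀ + c₁.
  have e0 := key (Pi.single 0 1) 0
  have e1 := key (Pi.single 1 1) 1
  have e2 := key (Pi.single 1 1) 0
  have e3 := key (Pi.single 0 1) 1
  have e4 := key (Pi.single 2 1) 0
  have e5 := key (Pi.single 0 1) 2
  simp at e0 e1 e2 e3 e4 e5
  rw [e0] at e1
  simp at e1
  exact ⟨e0, e1, e2, e3, e4, e5⟩

/-! ### Real coordinates on the three subspaces -/

theorem real_smul_eq (r : ℝ) (x : A₁) : r • x = (r : ℂ) • x := (algebraMap_smul ℂ r x).symm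

theorem mem_skewA₁0 {x : A₁} : x ∈ skewA₁0 ↔
    ∃ r s : ℝ, x = (r * Complex.I) • 1 + (s * Complex.I) • num := by
  simp only [skewA₁0, Submodule.mem_span_pair, real_smul_eq, smul_smul, num, eq_comm]

theorem mem_skewA₁1 {x : A₁} : x ∈ skewA₁1 ↔
    ∃ r s : ℝ, x = (s + r * Complex.I) • a + (-s + r * Complex.I) • ad := by
  simp only [skewA₁1, Submodule.mem_span_pair, real_smul_eq, smul_smul]
  refine exists_congr fun r => exists_congr fun s => ?_
  rw [eq_comm]
  refine Eq.congr rfl ?_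
  module

theorem mem_skewA₁2 {x : A₁} : x ∈ skewA₁2 ↔
    ∃ r s : ℝ, x = (s + r * Complex.I) • a ^ 2 + (-s + r * Complex.I) • ad ^ 2 := by
  simp only [skewA₁2, Submodule.mem_span_pair, real_smul_eq, smul_smul]
  refine exists_congr fun r => exists_congr fun s => ?_
  rw [eq_comm]
  refine Eq.congr rfl ?_
  module

theorem iSupIndep_skewA₁ : iSupIndep ![skewA₁0, skewA₁1, skewA₁2] := by
  have key : ∀ x ∈ skewA₁0, ∀ y ∈ skewA₁1, ∀ z ∈ skewA₁2, x + y + z = 0 →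
      x = 0 ∧ y = 0 ∧ z = 0 := by
    intro x hx y hy z hz h
    obtain ⟨r, s, rfl⟩ := mem_skewA₁0.1 hx
    obtain ⟨r', s', rfl⟩ := mem_skewA₁1.1 hy
    obtain ⟨r'', s'', rfl⟩ := mem_skewA₁2.1 hz
    obtain ⟨h0, h1, h2, h3, h4, h5⟩ :=
      coeff_eq_zero_of_quadratic_eq_zero ((add_assoc _ _ _).trans (by rw [← h]; abel))
    simp [h0, h1, h2, h3, h4, h5]
  rw [iSupIndep_fin_three]
  simp only [Matrix.cons_val_zero, Matrix.cons_val_one, Matrix.cons_val]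
  refine ⟨?_, ?_, ?_⟩ <;> rw [Submodule.disjoint_def] <;> intro x hx hx' <;>
    obtain ⟨y, hy, z, hz, rfl⟩ := Submodule.mem_sup.1 hx'
  · have := (key _ (neg_mem hx) y hy z hz (by abel)).1
    exact neg_eq_zero.1 this
  · have := (key _ hz _ (neg_mem hx) y hy (by abel)).2.1
    exact neg_eq_zero.1 this
  · have := (key y hy z hz _ (neg_mem hx) (by abel)).2.2
    exact neg_eq_zero.1 this

/-- Skew-hermitian elements of degree at most two. -/
theorem mem_sup_skewA₁ {x : A₁} (hx : x ∈ quadratic) (hs : star x = -x) :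
    x ∈ skewA₁0 ⊔ skewA₁1 ⊔ skewA₁2 := by
  simp only [quadratic, Submodule.mem_span_insert, Submodule.mem_span_singleton] at hx
  obtain ⟨c₀, _, ⟨c₁, _, ⟨c₂, _, ⟨c₃, _, ⟨c₄, _, ⟨c₅, rfl⟩, rfl⟩, rfl⟩, rfl⟩, rfl⟩, rfl⟩ := hx
  simp only [star_add, star_smul, star_one, star_num, star_a, star_ad, star_pow] at hs
  -- Dagger conjugates the coefficients and swaps those of a, a† and of a², (a†)². The two discarded
  -- equations are conjugates of `h2` and `h4`.
  obtain ⟨h0, h1, h2, -, h4, -⟩ := coeff_eq_zero_of_quadratic_eq_zero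
    (c₀ := star c₀ + c₀) (c₁ := star c₁ + c₁) (c₂ := star c₃ + c₂) (c₃ := star c₂ + c₃)
    (c₄ := star c₅ + c₄) (c₅ := star c₄ + c₅)
    (by rw [← sub_eq_zero, sub_neg_eq_add] at hs; rw [← hs]; module)
  have e0 : ∀ c : ℂ, star c + c = 0 → c = c.im * Complex.I := by
    intro c hc
    have := congrArg Complex.re hc
    simp at this
    apply Complex.ext <;> simp; linarith
  have e1 : ∀ c d : ℂ, star d + c = 0 → c = c.re + c.im * Complex.I ∧
      d = -c.re + c.im * Complex.I := by
    intro c d hc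
    have h1 := congrArg Complex.re hc
    have h2 := congrArg Complex.im hc
    simp at h1 h2
    constructor <;> apply Complex.ext <;> simp <;> linarith
  have : c₀ • 1 + (c₁ • num + (c₂ • a + (c₃ • ad + (c₄ • a ^ 2 + c₅ • ad ^ 2)))) =
    (c₀ • 1 + c₁ • num) + (c₂ • a + c₃ • ad) + (c₄ • a ^ 2 + c₅ • ad ^ 2) := by abel
  rw [this]
  refine Submodule.add_mem_sup (Submodule.add_mem_sup (mem_skewA₁0.2 ⟨c₀.im, c₁.im, ?_⟩)
    (mem_skewA₁1.2 ⟨c₂.im, c₂.re, ?_⟩)) (mem_skewA₁2.2 ⟨c₄.im, c₄.re, ?_⟩)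
  · rw [← e0 c₀ h0, ← e0 c₁ h1]
  · rw [← (e1 c₂ c₃ h2).1, ← (e1 c₂ c₃ h2).2]
  · rw [← (e1 c₄ c₅ h4).1, ← (e1 c₄ c₅ h4).2]

theorem sup_skewA₁_le_lieA₁le2 :
    skewA₁0 ⊔ skewA₁1 ⊔ skewA₁2 ≤ lieA₁le2.toSubmodule :=
  LieSubalgebra.subset_lieSpan

/-! ### Finite-dimensional Lie algebras that contain a free term -/

section

variable (g : LieSubalgebra ℝ A₁)

theorem commutator_mem_span {x y : A₁} (hx : x ∈ Submodule.span ℂ (g : Set A₁))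
    (hy : y ∈ Submodule.span ℂ (g : Set A₁)) :
    x * y - y * x ∈ Submodule.span ℂ (g : Set A₁) := by
  induction hx, hy using Submodule.span_induction₂ with
  | mem_mem x y hx hy => exact Submodule.subset_span (g.lie_mem hx hy)
  | zero_left y _ => simp
  | zero_right x _ => simp
  | add_left x y z _ _ _ h1 h2 =>
    rw [add_mul, mul_add, add_sub_add_comm]; exact add_mem h1 h2
  | add_right x y z _ _ _ h1 h2 =>
    rw [add_mul, mul_add, add_sub_add_comm]; exact add_mem h1 h2
  | smul_left r x y _ _ h =>
    rw [smul_mul_assoc, mul_smul_comm, ← smul_sub]; exact Submodule.smul_mem _ r h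
  | smul_right r x y _ _ h =>
    rw [smul_mul_assoc, mul_smul_comm, ← smul_sub]; exact Submodule.smul_mem _ r h

theorem star_mem_span (hg : g ≤ skewA₁) {x : A₁} (hx : x ∈ Submodule.span ℂ (g : Set A₁)) :
    star x ∈ Submodule.span ℂ (g : Set A₁) := by
  induction hx using Submodule.span_induction with
  | mem x hx =>
    have h : star x = -x := hg hx
    rw [h]
    exact neg_mem (Submodule.subset_span hx)
  | zero => simp
  | add x y _ _ hx hy => rw [star_add]; exact add_mem hx hy
  | smul c x _ hx => rw [star_smul]; exact Submodule.smul_mem _ _ hx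

/-- A real basis of `g` also generates the complex span. This yields both finite dimension over ℂ
and the comparison that carries the lower bound of three back to `g`. -/
theorem exists_finset_span [FiniteDimensional ℝ g] :
    ∃ s : Finset A₁, s.card ≤ Module.finrank ℝ g ∧
      Submodule.span ℂ (g : Set A₁) = Submodule.span ℂ (s : Set A₁) := by
  classical
  let b := Module.finBasis ℝ g
  refine ⟨Finset.univ.image fun i => (b i : A₁), ?_, ?_⟩
  · exact Finset.card_image_le.trans (by simp)
  · refine le_antisymm (Submodule.span_le.2 fun x hx => ?_) (Submodule.span_mono ?_)
    · have h := congrArg g.toSubmodule.subtype (b.sum_repr ⟨x, hx⟩)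
      rw [map_sum] at h
      change _ = x at h
      rw [← h]
      refine Submodule.sum_mem _ fun i _ => ?_
      rw [map_smul, real_smul_eq]
      exact Submodule.smul_mem _ _ (Submodule.subset_span (by simp))
    · intro x hx
      simp only [Finset.coe_image, Finset.coe_univ, Set.image_univ, Set.mem_range] at hx
      obtain ⟨i, rfl⟩ := hx
      exact (b i).2

theorem le_lieA₁le2_and_three_le_finrank (hg : g ≤ skewA₁) [FiniteDimensional ℝ g]
    (hab : ¬ IsLieAbelian g) (hfree : ∃ c : ℝ, freeTerm c ∈ g) :
    g ≤ lieA₁le2 ∧ 3 ≤ Module.finrank ℝ g := by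
  obtain ⟨s, hs, hspan⟩ := exists_finset_span g
  have hfin : FiniteDimensional ℂ (Submodule.span ℂ (g : Set A₁)) := by
    rw [hspan]; infer_instance
  obtain ⟨c, hc⟩ := hfree
  have hnum : num + (c : ℂ) • 1 ∈ Submodule.span ℂ (g : Set A₁) := by
    have h : num + (c : ℂ) • 1 = (-Complex.I) • freeTerm c := by
      rw [freeTerm, smul_add, smul_smul, smul_smul, ← mul_assoc]
      simp [num]
    rw [h]
    exact Submodule.smul_mem _ _ (Submodule.subset_span hc)
  have hcomm : ∃ x ∈ Submodule.span ℂ (g : Set A₁), ∃ y ∈ Submodule.span ℂ (g : Set A₁),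
      x * y ≠ y * x := by
    by_contra! h
    refine hab ⟨fun x y => Subtype.ext ?_⟩
    change (x : A₁) * y - y * x = 0
    rw [h _ (Submodule.subset_span x.2) _ (Submodule.subset_span y.2), sub_self]
  have hlie : ∀ x ∈ Submodule.span ℂ (g : Set A₁), ∀ y ∈ Submodule.span ℂ (g : Set A₁),
      x * y - y * x ∈ Submodule.span ℂ (g : Set A₁) :=
    fun x hx y hy => commutator_mem_span g hx hy
  have hstar : ∀ x ∈ Submodule.span ℂ (g : Set A₁), star x ∈ Submodule.span ℂ (g : Set A₁) :=
    fun x hx => star_mem_span g hg hx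
  constructor
  · intro x hx
    exact sup_skewA₁_le_lieA₁le2 (mem_sup_skewA₁
      (le_quadratic hlie hstar hnum hcomm (Submodule.subset_span hx)) (hg hx))
  · refine (three_le_finrank hlie hstar hnum hcomm).trans (le_trans ?_ hs)
    rw [hspan]
    exact finrank_span_finset_le_card s

end

/-! ### Generators and relations of the Schrödinger algebra -/

section

variable {L L' : Type*} [LieRing L] [LieAlgebra ℝ L] [LieRing L'] [LieAlgebra ℝ L']

/-- The commutation relations of the Schrödinger algebra. -/
structure SchrodingerRel (h x y q p z : L) : Prop where
  hx : ⁅h, x⁆ = (2 : ℝ) • x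
  hy : ⁅h, y⁆ = (-2 : ℝ) • y
  xy : ⁅x, y⁆ = h
  hq : ⁅h, q⁆ = q
  hp : ⁅h, p⁆ = -p
  xq : ⁅x, q⁆ = 0
  xp : ⁅x, p⁆ = q
  yq : ⁅y, q⁆ = p
  yp : ⁅y, p⁆ = 0
  qp : ⁅q, p⁆ = z
  central : ∀ u : L, ⁅z, u⁆ = 0

theorem isSchrodinger_iff : IsSchrodinger L ↔ ∃ (b : Module.Basis (Fin 6) ℝ L) (h x y q p z : L),
    ⇑b = ![h, x, y, q, p, z] ∧ SchrodingerRel h x y q p z := by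
  constructor
  · rintro ⟨b, h, x, y, q, p, z, hb, h1, h2, h3, h4, h5, h6, h7, h8, h9, h10, h11⟩
    exact ⟨b, h, x, y, q, p, z, hb, ⟨h1, h2, h3, h4, h5, h6, h7, h8, h9, h10, h11⟩⟩
  · rintro ⟨b, h, x, y, q, p, z, hb, ⟨h1, h2, h3, h4, h5, h6, h7, h8, h9, h10, h11⟩⟩
    exact ⟨b, h, x, y, q, p, z, hb, h1, h2, h3, h4, h5, h6, h7, h8, h9, h10, h11⟩

/-- The brackets of the basis elements of the Schrödinger algebra. -/
def bracketTable {M : Type*} [AddCommGroup M] [Module ℝ M] (b : Fin 6 → M) :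
    Fin 6 → Fin 6 → M :=
  ![![0, (2 : ℝ) • b 1, (-2 : ℝ) • b 2, b 3, -b 4, 0],
    ![(-2 : ℝ) • b 1, 0, b 0, 0, b 3, 0],
    ![(2 : ℝ) • b 2, -b 0, 0, b 4, 0, 0],
    ![-b 3, 0, -b 4, 0, b 5, 0],
    ![b 4, -b 3, 0, -b 5, 0, 0],
    ![0, 0, 0, 0, 0, 0]]

theorem SchrodingerRel.lie_eq {h x y q p z : L} (H : SchrodingerRel h x y q p z) (i j : Fin 6) :
    ⁅![h, x, y, q, p, z] i, ![h, x, y, q, p, z] j⁆ = bracketTable ![h, x, y, q, p, z] i j := by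
  have hz : ∀ u, ⁅u, z⁆ = 0 := fun u => by rw [← lie_skew, H.central, neg_zero]
  have h1 : ⁅x, h⁆ = (-2 : ℝ) • x := by rw [← lie_skew, H.hx, neg_smul]
  have h2 : ⁅y, h⁆ = (2 : ℝ) • y := by rw [← lie_skew, H.hy, neg_smul, neg_neg]
  have h3 : ⁅y, x⁆ = -h := by rw [← lie_skew, H.xy]
  have h4 : ⁅q, h⁆ = -q := by rw [← lie_skew, H.hq]
  have h5 : ⁅p, h⁆ = p := by rw [← lie_skew, H.hp, neg_neg]
  have h6 : ⁅q, x⁆ = 0 := by rw [← lie_skew, H.xq, neg_zero]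
  have h7 : ⁅p, x⁆ = -q := by rw [← lie_skew, H.xp]
  have h8 : ⁅q, y⁆ = -p := by rw [← lie_skew, H.yq]
  have h9 : ⁅p, y⁆ = 0 := by rw [← lie_skew, H.yp, neg_zero]
  have h10 : ⁅p, q⁆ = -z := by rw [← lie_skew, H.qp]
  fin_cases i
  · fin_cases j
    exacts [lie_self h, H.hx, H.hy, H.hq, H.hp, hz h]
  · fin_cases j
    exacts [h1, lie_self x, H.xy, H.xq, H.xp, hz x]
  · fin_cases j
    exacts [h2, h3, lie_self y, H.yq, H.yp, hz y]
  · fin_cases j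
    exacts [h4, h6, h8, lie_self q, H.qp, hz q]
  · fin_cases j
    exacts [h5, h7, h9, h10, lie_self p, hz p]
  · fin_cases j
    exacts [H.central h, H.central x, H.central y, H.central q, H.central p, hz z]

theorem map_bracketTable {M M' : Type*} [AddCommGroup M] [Module ℝ M] [AddCommGroup M']
    [Module ℝ M'] (e : M →ₗ[ℝ] M') (b : Fin 6 → M) (i j : Fin 6) :
    e (bracketTable b i j) = bracketTable (fun k => e (b k)) i j := by
  fin_cases i <;> fin_cases j <;> simp [bracketTable]

theorem bracketTable_mem_span {M : Type*} [AddCommGroup M] [Module ℝ M] (b : Fin 6 → M)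
    (i j : Fin 6) : bracketTable b i j ∈ Submodule.span ℝ (Set.range b) := by
  have hb : ∀ k, b k ∈ Submodule.span ℝ (Set.range b) := fun k => Submodule.subset_span ⟨k, rfl⟩
  fin_cases i <;> fin_cases j <;>
    simp [bracketTable, hb, Submodule.smul_mem, -neg_smul]

/-- The linear map matching the two bases respects brackets of basis vectors, as both follow
`bracketTable`; bilinearity does the rest. -/
theorem IsSchrodinger.nonempty_lieEquiv (hL : IsSchrodinger L) (hL' : IsSchrodinger L') :
    Nonempty (L ≃ₗ⁅ℝ⁆ L') := by
  obtain ⟨b, h, x, y, q, p, z, hb, H⟩ := isSchrodinger_iff.1 hL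
  obtain ⟨b', h', x', y', q', p', z', hb', H'⟩ := isSchrodinger_iff.1 hL'
  let e : L ≃ₗ[ℝ] L' := b.equiv b' (Equiv.refl _)
  have he : ∀ i, e (b i) = b' i := fun i => by simp [e]
  have key : ∀ i j, e ⁅b i, b j⁆ = ⁅e (b i), e (b j)⁆ := by
    intro i j
    have h1 : ⁅b i, b j⁆ = bracketTable b i j := by rw [hb]; exact H.lie_eq i j
    have h2 : ⁅b' i, b' j⁆ = bracketTable b' i j := by rw [hb']; exact H'.lie_eq i j
    rw [he, he, h1, h2]
    refine (map_bracketTable e.toLinearMap b i j).trans ?_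
    congr 1
    exact funext he
  have hmap : ∀ u v, e ⁅u, v⁆ = ⁅e u, e v⁆ := by
    have hB : (LieModule.toEnd ℝ L L : L →ₗ[ℝ] Module.End ℝ L).compr₂ e.toLinearMap =
        (LieModule.toEnd ℝ L' L' : L' →ₗ[ℝ] Module.End ℝ L').compl₁₂ e.toLinearMap
          e.toLinearMap :=
      b.ext fun i => b.ext fun j => key i j
    exact fun u v => LinearMap.congr_fun (LinearMap.congr_fun hB u) v
  exact ⟨{ e with map_lie' := fun {u v} => hmap u v }⟩

end

/-! ### The semidirect sum is the Schrödinger algebra -/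

/-- The traceless matrix with entries `r, s, t, -r`. -/
def tracelessMatrix (r s t : ℝ) : LieAlgebra.SpecialLinear.sl (Fin 2) ℝ :=
  ⟨!![r, s; t, -r], by
    change Matrix.trace !![r, s; t, -r] = 0
    simp [Matrix.trace, Fin.sum_univ_two]⟩

/-- An element of the semidirect sum, by coordinates. -/
def ofCoords (c : Fin 6 → ℝ) : SL2Heis :=
  ⟨⟨c 3, c 4, c 5⟩, tracelessMatrix (c 0) (c 1) (c 2)⟩

theorem sl2Heis_ext {u v : SL2Heis} (h1 : u.left = v.left) (h2 : u.right.1 = v.right.1) : u = v :=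
  LieAlgebra.SemiDirectSum.ext h1 (Subtype.ext h2)

/-- The coordinates on the semidirect sum. -/
noncomputable def coordsEquiv : SL2Heis ≃ₗ[ℝ] (Fin 6 → ℝ) where
  toFun u := ![u.right.1 0 0, u.right.1 0 1, u.right.1 1 0, u.left.q, u.left.p, u.left.z]
  invFun := ofCoords
  map_add' u v := by
    ext i; fin_cases i <;> simp
  map_smul' r u := by
    ext i; fin_cases i <;> simp
  left_inv u := by
    refine sl2Heis_ext rfl ?_
    have h : Matrix.trace u.right.1 = 0 := u.right.2
    rw [Matrix.trace_fin_two] at h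
    ext i j
    fin_cases i <;> fin_cases j <;> simp [ofCoords, tracelessMatrix]
    linarith
  right_inv c := by
    ext i; fin_cases i <;> simp [ofCoords, tracelessMatrix]

/-- Entries 0 to 2 are the matrix commutator, entries 3 and 4 the difference of the two matrix
actions on (q, p), and entry 5 the symplectic form of the Heisenberg bracket. -/
theorem lie_ofCoords (c d : Fin 6 → ℝ) : ⁅ofCoords c, ofCoords d⁆ = ofCoords
    ![c 1 * d 2 - c 2 * d 1, 2 * (c 0 * d 1 - c 1 * d 0), 2 * (c 2 * d 0 - c 0 * d 2),
      c 0 * d 3 + c 1 * d 4 - (d 0 * c 3 + d 1 * c 4),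
      c 2 * d 3 - c 0 * d 4 - (d 2 * c 3 - d 0 * c 4), c 3 * d 4 - c 4 * d 3] := by
  refine sl2Heis_ext ?_ ?_
  · change ⁅(ofCoords c).left, (ofCoords d).left⁆ + sl2Act (ofCoords c).right (ofCoords d).left -
      sl2Act (ofCoords d).right (ofCoords c).left = _
    ext <;> simp [ofCoords, tracelessMatrix, sl2Act]
    all_goals ring
  · change ⁅(ofCoords c).right.1, (ofCoords d).right.1⁆ = _
    ext i j
    fin_cases i <;> fin_cases j <;>
      simp [ofCoords, tracelessMatrix, Ring.lie_def] <;> ring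

theorem isSchrodinger_sl2Heis : IsSchrodinger SL2Heis := by
  have hsymm : ∀ c, coordsEquiv.symm c = ofCoords c := fun _ => rfl
  refine isSchrodinger_iff.2 ⟨Module.Basis.ofEquivFun coordsEquiv, ofCoords (Pi.single 0 1),
    ofCoords (Pi.single 1 1), ofCoords (Pi.single 2 1), ofCoords (Pi.single 3 1),
    ofCoords (Pi.single 4 1), ofCoords (Pi.single 5 1), ?_, ?_⟩
  · ext1 i
    rw [Module.Basis.coe_ofEquivFun]
    fin_cases i <;> rfl
  · constructor
    all_goals
      -- Only centrality of z quantifies over a vector. Every relation becomes an identity of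
      -- coordinate vectors.
      try intro u; obtain ⟨c, rfl⟩ := coordsEquiv.symm.surjective u
      simp only [← hsymm, ← map_smul, ← map_neg]
      try rw [← map_zero coordsEquiv.symm]
      simp only [hsymm, lie_ofCoords]
      congr 1
      ext i
      fin_cases i <;> simp

/-! ### The quadratic elements form the Schrödinger algebra -/

/-- The basis `h, x, y, q, p, z` of the Schrödinger algebra inside the Weyl algebra. -/
noncomputable def schrodingerVec : Fin 6 → A₁ :=
  ![(1 / 2 : ℂ) • (a ^ 2 - ad ^ 2),
    (-Complex.I / 4) • (a ^ 2 + ad ^ 2 + (2 : ℂ) • num + 1),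
    (-Complex.I / 4) • (a ^ 2 + ad ^ 2 - (2 : ℂ) • num - 1),
    Complex.I • (a + ad), a - ad, (-2 * Complex.I) • 1]

/-- Right-nested form of the commutation relation, so that rewriting brings words to normal order.
-/
theorem a_mul_ad_mul (u : A₁) : a * (ad * u) = ad * (a * u) + u := by
  rw [← mul_assoc, a_mul_ad, add_mul, one_mul, mul_assoc]

/-- With q = i(a + a†) and p = a - a† one has z = [q, p] = -2i. The other vectors are x = (i/4) q²,
y = -(i/4) p² and h = -(i/4)(qp + pq), where the factor i/4 is fixed by [x, p] = q and [y, q] = p.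
-/
theorem schrodingerRel_schrodingerVec : SchrodingerRel (schrodingerVec 0) (schrodingerVec 1)
    (schrodingerVec 2) (schrodingerVec 3) (schrodingerVec 4) (schrodingerVec 5) := by
  constructor
  case central => intro u; simp [schrodingerVec, Ring.lie_def]
  all_goals
    simp only [schrodingerVec, Matrix.cons_val, Ring.lie_def, real_smul_eq, num, pow_two, mul_add,
      add_mul, mul_sub, sub_mul, smul_mul_assoc, mul_smul_comm, mul_assoc, a_mul_ad_mul, a_mul_ad,
      mul_one, one_mul]
    push_cast
    match_scalars <;> first | ring1 | (ring_nf; rw [Complex.I_sq]; try norm_num)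

theorem linearIndependent_schrodingerVec : LinearIndependent ℝ schrodingerVec := by
  rw [Fintype.linearIndependent_iff]
  intro c hc
  have h : (-Complex.I / 4 * (c 1 - c 2) - 2 * Complex.I * c 5) • (1 : A₁) +
      (-Complex.I / 2 * (c 1 - c 2)) • num + (c 3 * Complex.I + c 4) • a +
      (c 3 * Complex.I - c 4) • ad + (c 0 / 2 - Complex.I / 4 * (c 1 + c 2)) • a ^ 2 +
      (-c 0 / 2 - Complex.I / 4 * (c 1 + c 2)) • ad ^ 2 = 0 := by
    rw [← hc, Fin.sum_univ_six]
    simp only [schrodingerVec, Matrix.cons_val, real_smul_eq]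
    module
  obtain ⟨h0, h1, h2, -, h4, -⟩ := coeff_eq_zero_of_quadratic_eq_zero h
  have e0 := congrArg Complex.im h0
  have e1 := congrArg Complex.im h1
  have e2 := congrArg Complex.im h2
  have e3 := congrArg Complex.re h2
  have e4 := congrArg Complex.re h4
  have e5 := congrArg Complex.im h4
  simp at e0 e1 e2 e3 e4 e5
  intro i
  fin_cases i <;> simp <;> linarith

theorem schrodingerVec_mem_quadratic (i : Fin 6) : schrodingerVec i ∈ quadratic := by
  have h1 : (1 : A₁) ∈ quadratic := Submodule.subset_span (by simp)
  have h2 : num ∈ quadratic := Submodule.subset_span (by simp)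
  have h3 : a ∈ quadratic := Submodule.subset_span (by simp)
  have h4 : ad ∈ quadratic := Submodule.subset_span (by simp)
  have h5 : a ^ 2 ∈ quadratic := Submodule.subset_span (by simp)
  have h6 : ad ^ 2 ∈ quadratic := Submodule.subset_span (by simp)
  have h7 := quadratic.smul_mem (2 : ℂ) h2
  fin_cases i
  · exact Submodule.smul_mem _ _ (sub_mem h5 h6)
  · exact Submodule.smul_mem _ _ (add_mem (add_mem (add_mem h5 h6) h7) h1)
  · exact Submodule.smul_mem _ _ (sub_mem (sub_mem (add_mem h5 h6) h7) h1)
  · exact Submodule.smul_mem _ _ (add_mem h3 h4)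
  · exact sub_mem h3 h4
  · exact Submodule.smul_mem _ _ h1

theorem star_schrodingerVec (i : Fin 6) : star (schrodingerVec i) = -schrodingerVec i := by
  fin_cases i <;> simp [schrodingerVec, star_smul, star_a, star_ad, star_num] <;> module

theorem skewA₁_sup_le_span :
    skewA₁0 ⊔ skewA₁1 ⊔ skewA₁2 ≤ Submodule.span ℝ (Set.range schrodingerVec) := by
  have hv : ∀ c : Fin 6 → ℝ,
      ∑ i, c i • schrodingerVec i ∈ Submodule.span ℝ (Set.range schrodingerVec) := fun c =>
    Submodule.sum_mem _ fun i _ => Submodule.smul_mem _ _ (Submodule.subset_span ⟨i, rfl⟩)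
  refine sup_le (sup_le ?_ ?_) ?_
  · intro x hx
    obtain ⟨r, s, rfl⟩ := mem_skewA₁0.1 hx
    -- Here i = -z/2 and i a†a = y - x + z/4.
    convert hv ![0, -s, s, 0, 0, s / 4 - r / 2] using 1
    simp only [Fin.sum_univ_six, schrodingerVec, Matrix.cons_val, real_smul_eq]
    push_cast
    module
  · intro x hx
    obtain ⟨r, s, rfl⟩ := mem_skewA₁1.1 hx
    convert hv ![0, 0, 0, r, s, 0] using 1
    simp only [Fin.sum_univ_six, schrodingerVec, Matrix.cons_val, real_smul_eq]
    push_cast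
    module
  · intro x hx
    obtain ⟨r, s, rfl⟩ := mem_skewA₁2.1 hx
    -- Here i(a² + (a†)²) = -2(x + y) and a² - (a†)² = 2h.
    convert hv ![2 * s, -2 * r, -2 * r, 0, 0, 0] using 1
    simp only [Fin.sum_univ_six, schrodingerVec, Matrix.cons_val, real_smul_eq]
    push_cast
    module

theorem lie_schrodingerVec (i j : Fin 6) :
    ⁅schrodingerVec i, schrodingerVec j⁆ = bracketTable schrodingerVec i j :=
  schrodingerRel_schrodingerVec.lie_eq i j

/-- The span of the Schrödinger basis, as a Lie subalgebra. -/
noncomputable def schrodingerSpan : LieSubalgebra ℝ A₁ where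
  toSubmodule := Submodule.span ℝ (Set.range schrodingerVec)
  lie_mem' {u v} hu hv := by
    change u ∈ Submodule.span ℝ (Set.range schrodingerVec) at hu
    change v ∈ Submodule.span ℝ (Set.range schrodingerVec) at hv
    change ⁅u, v⁆ ∈ Submodule.span ℝ (Set.range schrodingerVec)
    induction hu, hv using Submodule.span_induction₂ with
    | mem_mem x y hx hy =>
      obtain ⟨i, rfl⟩ := hx
      obtain ⟨j, rfl⟩ := hy
      rw [lie_schrodingerVec]
      exact bracketTable_mem_span _ i j
    | zero_left y _ => simp
    | zero_right x _ => simp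
    | add_left x y z _ _ _ h1 h2 => rw [add_lie]; exact add_mem h1 h2
    | add_right x y z _ _ _ h1 h2 => rw [lie_add]; exact add_mem h1 h2
    | smul_left r x y _ _ h => rw [smul_lie]; exact Submodule.smul_mem _ r h
    | smul_right r x y _ _ h => rw [lie_smul]; exact Submodule.smul_mem _ r h

/-- The generating subspace is already closed under brackets, so generation adds nothing. -/
theorem lieA₁le2_eq : lieA₁le2 = schrodingerSpan := by
  refine le_antisymm (LieSubalgebra.lieSpan_le.2 fun x hx => skewA₁_sup_le_span hx) ?_
  have h : Submodule.span ℝ (Set.range schrodingerVec) ≤ lieA₁le2.toSubmodule := by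
    rw [Submodule.span_le]
    rintro _ ⟨i, rfl⟩
    exact sup_skewA₁_le_lieA₁le2
      (mem_sup_skewA₁ (schrodingerVec_mem_quadratic i) (star_schrodingerVec i))
  exact h

theorem lieA₁le2_le_skewA₁ : lieA₁le2 ≤ skewA₁ := by
  have h : Submodule.span ℝ (Set.range schrodingerVec) ≤ skewA₁.toSubmodule := by
    rw [Submodule.span_le]
    rintro _ ⟨i, rfl⟩
    exact star_schrodingerVec i
  rw [lieA₁le2_eq]
  exact h

theorem isSchrodinger_schrodingerSpan : IsSchrodinger schrodingerSpan := by
  let b : Module.Basis (Fin 6) ℝ schrodingerSpan :=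
    Module.Basis.span linearIndependent_schrodingerVec
  have hb : ∀ i, (b i : A₁) = schrodingerVec i := fun i =>
    congrArg Subtype.val (Module.Basis.span_apply linearIndependent_schrodingerVec i)
  have H := schrodingerRel_schrodingerVec
  refine isSchrodinger_iff.2 ⟨b, b 0, b 1, b 2, b 3, b 4, b 5, ?_, ?_⟩
  · ext1 i
    fin_cases i <;> rfl
  · simp only [← hb] at H
    exact ⟨Subtype.ext H.hx, Subtype.ext H.hy, Subtype.ext H.xy, Subtype.ext H.hq,
      Subtype.ext H.hp, Subtype.ext H.xq, Subtype.ext H.xp, Subtype.ext H.yq, Subtype.ext H.yp,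
      Subtype.ext H.qp, fun u => Subtype.ext (H.central u)⟩

theorem isSchrodinger_lieA₁le2 : IsSchrodinger lieA₁le2 := by
  rw [lieA₁le2_eq]
  exact isSchrodinger_schrodingerSpan

end Weyl

theorem mainTheorem4 :
    (iSupIndep ![Weyl.skewA₁0, Weyl.skewA₁1, Weyl.skewA₁2] ∧
      Weyl.lieA₁le2 ≤ Weyl.skewA₁ ∧
      Weyl.IsSchrodinger Weyl.lieA₁le2 ∧
      Nonempty (Weyl.lieA₁le2 ≃ₗ⁅ℝ⁆ Weyl.SL2Heis)) ∧
    ∀ g : LieSubalgebra ℝ Weyl.A₁, g ≤ Weyl.skewA₁ → FiniteDimensional ℝ g →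
      ¬ IsLieAbelian g → (∃ c : ℝ, Weyl.freeTerm c ∈ g) →
      g ≤ Weyl.lieA₁le2 ∧ 3 ≤ Module.finrank ℝ g :=
  ⟨⟨Weyl.iSupIndep_skewA₁, Weyl.lieA₁le2_le_skewA₁, Weyl.isSchrodinger_lieA₁le2,
    Weyl.isSchrodinger_lieA₁le2.nonempty_lieEquiv Weyl.isSchrodinger_sl2Heis⟩,
    fun g hg _ hab hfree => Weyl.le_lieA₁le2_and_three_le_finrank g hg hab hfree⟩
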